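/- Let $\Omega/k$ be a Galois extension of fields, possibly infinite, and let $\Gamma=\mathrm{Gal}(\Omega/k)$. An *algebraic scheme* over a field $F$ is a separated scheme of finite type over $\operatorname{Spec}F$. For a homomorphism of fields $i\colon F\to L$ and a scheme $V$ over $F$, write $iV=V\times_{\operatorname{Spec}F}\operatorname{Spec}L$, also denoted $V_L$, and write $i\alpha\colon iV\to iW$ for the base change of an $F$-morphism $\alpha\colon V\to W$. We identify $j(iV)$ with $(j\circ i)V$ by the canonical isomorphism. Let $V$ be an algebraic scheme over $\Omega$. A *descent system* on $V$ is a family $(\varphi_\sigma)_{\sigma\in\Gamma}$ of isomorphisms $\varphi_\sigma\colon\sigma V\to V$ over $\Omega$ such that $\varphi_\sigma\circ(\sigma\varphi_\tau)=\varphi_{\sigma\tau}$ for all $\sigma,\tau\in\Gamma$. For a field $K$ with $k\subset K\subset\Omega$, a *model* of $V$ over $K$ is an algebraic scheme $V_0$ over $K$ together with an isomorphism $\varphi\colon V\to V_{0\Omega}$ over $\Omega$. It *splits* the descent system if $\varphi_\sigma=\varphi^{-1}\circ\sigma\varphi$ for all $\sigma\in\Gamma$ fixing $K$, where $\sigma(V_{0\Omega})$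 is identified with $V_{0\Omega}$. A *descent datum* is a descent system that is split by some model over a subfield $K$ of $\Omega$ that contains $k$ and is finitely generated over $k$. A descent datum is *effective* if it is split by some model over $k$. For an open subscheme $U$ of $V$, put ${}^{\sigma}U=\varphi_\sigma(\sigma U)$. **Theorem.** Let $(\varphi_\sigma)_{\sigma\in\Gamma}$ be a descent datum on an algebraic scheme $V$ over $\Omega$. If $V$ is covered by open affine subschemes $U$ such that ${}^{\sigma}U=U$ for all $\sigma\in\Gamma$, then the descent datum is effective. -/

import Mathlib

open CategoryTheory CategoryTheory.Limits AlgebraicGeometry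

universe u

noncomputable section

namespace FieldDescent

/-- Schemes over a field `F`: objects are schemes `V` with a structure morphism `V ⟶ Spec F`, and
morphisms are the `F`-morphisms. -/
abbrev SchemesOver (F : Type u) [Field F] : Type (u + 1) :=
  Over (Spec (CommRingCat.of F))

/-- An algebraic scheme over `F` is a separated scheme of finite type over `Spec F`. -/
structure IsAlgebraicScheme {F : Type u} [Field F] (V : SchemesOver F) : Prop where
  separated : IsSeparated V.hom
  locallyOfFiniteType : LocallyOfFiniteType V.hom
  quasiCompact : QuasiCompact V.hom

/-- The base change functor along a homomorphism of fields `i : F → L`. On objects it is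
`V ↦ iV = V ×_{Spec F} Spec L`, and on morphisms it is `α ↦ iα`. -/
abbrev baseChange {F L : Type u} [Field F] [Field L] (i : F →+* L) :
    SchemesOver F ⥤ SchemesOver L :=
  Over.pullback (Spec.map (CommRingCat.ofHom i))

/-- The projection `iV ⟶ V`. -/
abbrev proj {F L : Type u} [Field F] [Field L] (i : F →+* L) (V : SchemesOver F) :
    ((baseChange i).obj V).left ⟶ V.left :=
  pullback.fst V.hom (Spec.map (CommRingCat.ofHom i))

lemma proj_condition {F L : Type u} [Field F] [Field L] (i : F →+* L) (V : SchemesOver F) :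
    proj i V ≫ V.hom = ((baseChange i).obj V).hom ≫ Spec.map (CommRingCat.ofHom i) :=
  pullback.condition

lemma specMap_comp {F L M : Type u} [Field F] [Field L] [Field M]
    {i : F →+* L} {j : L →+* M} {h : F →+* M} (e : j.comp i = h) :
    Spec.map (CommRingCat.ofHom j) ≫ Spec.map (CommRingCat.ofHom i) =
      Spec.map (CommRingCat.ofHom h) := by
  subst e
  rw [CommRingCat.ofHom_comp, Spec.map_comp]

/-- The morphism `T ⟶ iV` over `L` defined by a morphism `T ⟶ V` compatible with
`Spec L ⟶ Spec F`. -/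
def baseChangeLift {F L : Type u} [Field F] [Field L] (i : F →+* L) {V : SchemesOver F}
    {T : SchemesOver L} (f : T.left ⟶ V.left)
    (w : f ≫ V.hom = T.hom ≫ Spec.map (CommRingCat.ofHom i)) : T ⟶ (baseChange i).obj V :=
  Over.homMk (pullback.lift f T.hom w) (pullback.lift_snd _ _ _)

lemma baseChangeLift_proj {F L : Type u} [Field F] [Field L] (i : F →+* L) {V : SchemesOver F}
    {T : SchemesOver L} (f : T.left ⟶ V.left)
    (w : f ≫ V.hom = T.hom ≫ Spec.map (CommRingCat.ofHom i)) :
    (baseChangeLift i f w).left ≫ proj i V = f :=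
  pullback.lift_fst _ _ _

lemma baseChange_hom_ext {F L : Type u} [Field F] [Field L] (i : F →+* L) {V : SchemesOver F}
    {T : SchemesOver L} {f g : T ⟶ (baseChange i).obj V}
    (e : f.left ≫ proj i V = g.left ≫ proj i V) : f = g := by
  ext1
  exact pullback.hom_ext e ((Over.w f).trans (Over.w g).symm)

/-- The canonical isomorphism `j(iV) ≅ hV` of schemes over `M`, where `h = j ∘ i` for homomorphisms
of fields `i : F → L` and `j : L → M`. It is the one compatible with the projections to `V`. -/
def baseChangeComp {F L M : Type u} [Field F] [Field L] [Field M]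
    {i : F →+* L} {j : L →+* M} {h : F →+* M} (e : j.comp i = h) (V : SchemesOver F) :
    (baseChange j).obj ((baseChange i).obj V) ≅ (baseChange h).obj V where
  hom := baseChangeLift h (proj j ((baseChange i).obj V) ≫ proj i V) (by
    rw [Category.assoc, proj_condition, ← Category.assoc, proj_condition, Category.assoc,
      specMap_comp e])
  inv := baseChangeLift j
    (baseChangeLift i (T := Over.mk (((baseChange h).obj V).hom ≫ Spec.map (CommRingCat.ofHom j)))
      (proj h V) (by
        rw [proj_condition, ← specMap_comp e]
        exact (Category.assoc _ _ _).symm)).left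
    (Over.w _)
  hom_inv_id := by
    apply baseChange_hom_ext
    rw [Over.comp_left, Category.assoc, baseChangeLift_proj, Over.id_left, Category.id_comp]
    apply pullback.hom_ext
    · refine (Category.assoc _ _ _).trans ?_
      refine (congrArg _ (baseChangeLift_proj i _ _)).trans ?_
      exact baseChangeLift_proj h _ _
    · refine (Category.assoc _ _ _).trans ?_
      refine (congrArg _ (Over.w (baseChangeLift i _ _))).trans ?_
      refine (Category.assoc _ _ _).symm.trans ?_
      refine (congrArg (· ≫ _) (Over.w (baseChangeLift h _ _))).trans ?_
      exact (proj_condition j ((baseChange i).obj V)).symm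
  inv_hom_id := by
    apply baseChange_hom_ext
    rw [Over.comp_left, Category.assoc, baseChangeLift_proj, Over.id_left, Category.id_comp,
      ← Category.assoc, baseChangeLift_proj, baseChangeLift_proj]

lemma baseChangeComp_hom_proj {F L M : Type u} [Field F] [Field L] [Field M]
    {i : F →+* L} {j : L →+* M} {h : F →+* M} (e : j.comp i = h) (V : SchemesOver F) :
    (baseChangeComp e V).hom.left ≫ proj h V = proj j ((baseChange i).obj V) ≫ proj i V :=
  baseChangeLift_proj _ _ _

/-- A model of `V` (over `Ω`) over a field `K` with an embedding `K → Ω`: an algebraic scheme `V₀`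
over `K` together with an isomorphism `φ : V ≅ V₀_Ω` over `Ω`. -/
structure Model (K : Type u) {Ω : Type u} [Field K] [Field Ω] [Algebra K Ω]
    (V : SchemesOver Ω) where
  V₀ : SchemesOver K
  isAlgebraicScheme : IsAlgebraicScheme V₀
  φ : V ≅ (baseChange (algebraMap K Ω)).obj V₀

lemma coe_comp_coe {k Ω : Type u} [Field k] [Field Ω] [Algebra k Ω] (σ τ : Ω ≃ₐ[k] Ω) :
    (σ : Ω →+* Ω).comp (τ : Ω →+* Ω) = ((σ * τ : Ω ≃ₐ[k] Ω) : Ω →+* Ω) :=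
  rfl

/-- An `Ω/k`-descent system on `V`: a family of isomorphisms `φ_σ : σV ≅ V` over `Ω`, indexed by
`σ ∈ Aut(Ω/k)`, such that `φ_σ ∘ (σ φ_τ) = φ_{στ}`, where `σ(τV)` and `(στ)V` are identified by
the canonical isomorphism. -/
structure DescentSystem (k : Type u) {Ω : Type u} [Field k] [Field Ω] [Algebra k Ω]
    (V : SchemesOver Ω) where
  φ (σ : Ω ≃ₐ[k] Ω) : (baseChange (σ : Ω →+* Ω)).obj V ≅ V
  cocycle (σ τ : Ω ≃ₐ[k] Ω) :
    (baseChange (σ : Ω →+* Ω)).map (φ τ).hom ≫ (φ σ).hom =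
      (baseChangeComp (i := (τ : Ω →+* Ω)) (j := (σ : Ω →+* Ω))
        (h := ((σ * τ : Ω ≃ₐ[k] Ω) : Ω →+* Ω)) (coe_comp_coe σ τ) V).hom ≫ (φ (σ * τ)).hom

namespace DescentSystem

variable {k Ω : Type u} [Field k] [Field Ω] [Algebra k Ω] {V : SchemesOver Ω}

/-- The model `(V₀, φ)` of `V` over `K` splits the descent system: `φ_σ = φ⁻¹ ∘ σφ` for all `σ`
fixing `K`, where `σ(V₀_Ω)` and `V₀_Ω` are identified by the canonical isomorphism. -/
def IsSplitBy (D : DescentSystem k V) {K : Type u} [Field K] [Algebra K Ω] (M : Model K V) : Prop :=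
  ∀ (σ : Ω ≃ₐ[k] Ω) (hσ : (σ : Ω →+* Ω).comp (algebraMap K Ω) = algebraMap K Ω),
    (D.φ σ).hom =
      (baseChange (σ : Ω →+* Ω)).map M.φ.hom ≫ (baseChangeComp hσ M.V₀).hom ≫ M.φ.inv

/-- A descent system is continuous if it is split by some model over a subfield of `Ω` that is
finitely generated over `k` (as a field extension). A descent datum is a continuous descent
system. -/
def IsContinuous (D : DescentSystem k V) : Prop :=
  ∃ K : IntermediateField k Ω, K.FG ∧ ∃ M : Model K V, D.IsSplitBy M

/-- A descent datum is effective if it is split by some model over `k`. -/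
def IsEffective (D : DescentSystem k V) : Prop :=
  ∃ M : Model k V, D.IsSplitBy M

instance isIso_φ_left (D : DescentSystem k V) (σ : Ω ≃ₐ[k] Ω) : IsIso (D.φ σ).hom.left :=
  inferInstanceAs (IsIso ((Over.forget _).map (D.φ σ).hom))

/-- For an open subscheme `U` of `V`, the open subscheme `^σU = φ_σ(σU)` of `V`; here `σU`, as an
open subscheme of `σV`, is the inverse image of `U` under the projection `σV ⟶ V`. -/
def twist (D : DescentSystem k V) (σ : Ω ≃ₐ[k] Ω) (U : V.left.Opens) : V.left.Opens :=
  (D.φ σ).hom.left ''ᵁ (proj (σ : Ω →+* Ω) V ⁻¹ᵁ U)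

end DescentSystem

end FieldDescent

end

/-! A descent system amounts to a semilinear action of $\mathrm{Gal}(\Omega/k)$ on the scheme $V$
itself, and a model over $K$ splits it exactly when the map from $V$ to the model is invariant under
the automorphisms fixing $K$ (`isSplitBy_iff`). So one needs a quotient of $V$ over $k$ whose base
change to $\Omega$ is $V$.

On an invariant affine open $U$ the quotient must be the spectrum of the invariant sections. Galois
descent for algebras (`isPushout_invariants`) recovers all sections from these, provided each
section is fixed by an open subgroup. This is where the splitting model enters: its field is finite
over $k$, locally on $U$ a section is a fraction of expressions in sections of the model and scalars
of $\Omega$, and finitely many such pieces cover $U$ (`isContinuousSection_of_isCompact`).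

Separatedness makes invariant affine opens stable under intersection, so their quotients glue
(`exists_isPullback_of_charts`); the transition maps are open immersions because this can be checked
after a faithfully flat base change. Separatedness and finite type descend in the same way. -/

noncomputable section

namespace FieldDescent

/-! ### Galois descent for algebras -/

section Algebra

variable {k Ω : Type*} [Field k] [Field Ω] [Algebra k Ω]

lemma exists_algEquiv_extending [Normal k Ω] (L : IntermediateField k Ω) (e : L →ₐ[k] Ω) :
    ∃ σ : Ω ≃ₐ[k] Ω, ∀ x : L, σ x = e x :=
  ⟨AlgEquiv.ofBijective (e.liftNormal Ω) (Algebra.IsAlgebraic.algHom_bijective _), fun x ↦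
    e.liftNormal_commutes Ω x⟩

variable {A : Type*} [CommRing A] [Algebra Ω A] (ρ : (Ω ≃ₐ[k] Ω) → A →+* A)

/-- Every element fixed by an open subgroup lies in the `Ω`-span of the invariants of a semilinear
Galois action. -/
lemma mem_span_invariants [IsGalois k Ω] (hmul : ∀ σ τ a, ρ (σ * τ) a = ρ σ (ρ τ a))
    (hsemi : ∀ σ c, ρ σ (algebraMap Ω A c) = algebraMap Ω A (σ c))
    (L : IntermediateField k Ω) [FiniteDimensional k L] {a : A}
    (ha : ∀ σ : Ω ≃ₐ[k] Ω, (∀ x ∈ L, σ x = x) → ρ σ a = a) :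
    a ∈ Submodule.span Ω {b : A | ∀ σ, ρ σ b = b} := by
  -- A functional `f` kills the invariants but not `a`. It is tested on the traces `t x` of the
  -- multiples `x * a` with `x` in `L`, which are invariant.
  by_contra hna
  obtain ⟨f, hfa, hf⟩ := Submodule.exists_le_ker_of_notMem hna
  choose s hs using exists_algEquiv_extending L
  let t (x : L) : A := ∑ e : L →ₐ[k] Ω, ρ (s e) (algebraMap Ω A x * a)
  have hfix (x : L) (τ : Ω ≃ₐ[k] Ω) (hτ : ∀ y ∈ L, τ y = y) :
      ρ τ (algebraMap Ω A x * a) = algebraMap Ω A x * a := by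
    rw [map_mul, hsemi, hτ _ x.2, ha τ hτ]
  have ht (x : L) (τ : Ω ≃ₐ[k] Ω) : ρ τ (t x) = t x := by
    rw [map_sum]
    refine Finset.sum_bijective (fun e : L →ₐ[k] Ω ↦ (τ : Ω →ₐ[k] Ω).comp e) ?_ (by simp) ?_
    · refine ⟨fun e e' h ↦ ?_, fun e ↦ ⟨(τ.symm : Ω →ₐ[k] Ω).comp e, ?_⟩⟩
      · ext y
        exact τ.injective (DFunLike.congr_fun h y)
      · ext y
        simp
    · intro e _
      -- `τ * s e` and the chosen extension of `τ ∘ e` agree on `L`, so they differ by an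
      -- automorphism fixing `L`, which acts trivially on `x * a`.
      have key : τ * s e = s ((τ : Ω →ₐ[k] Ω).comp e) *
          ((s ((τ : Ω →ₐ[k] Ω).comp e))⁻¹ * (τ * s e)) := by group
      rw [← hmul, key, hmul, hfix]
      intro y hy
      change (s ((τ : Ω →ₐ[k] Ω).comp e)).symm (τ (s e y)) = y
      rw [AlgEquiv.symm_apply_eq, hs _ ⟨y, hy⟩, hs _ ⟨y, hy⟩]
      rfl
  have hsum (x : L) : ∑ e : L →ₐ[k] Ω, f (ρ (s e) a) * e x = 0 := by
    have h0 : f (t x) = 0 := hf (Submodule.subset_span (ht x))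
    rw [map_sum] at h0
    rw [← h0]
    refine Finset.sum_congr rfl fun e _ ↦ ?_
    rw [map_mul, hsemi, hs, ← Algebra.smul_def, map_smul, smul_eq_mul, mul_comm]
  -- Dedekind: the embeddings of `L` are independent, so every `f (ρ (s e) a)` vanishes. For the
  -- inclusion `L.val` this value is `f a`.
  have hli : LinearIndependent Ω (fun e : L →ₐ[k] Ω ↦ (e : L → Ω)) :=
    (linearIndependent_monoidHom L Ω).comp (fun e : L →ₐ[k] Ω ↦ (e : L →* Ω)) fun e e' h ↦ by
      ext y
      exact DFunLike.congr_fun h y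
  have := Fintype.linearIndependent_iff.mp hli (fun e ↦ f (ρ (s e) a)) (by
    ext x
    simpa using hsum x) L.val
  rw [ha _ fun y hy ↦ hs L.val ⟨y, hy⟩] at this
  exact hfa this

/-- Invariants of a semilinear Galois action that are linearly independent over the base field are
linearly independent over the big field. -/
lemma linearIndependent_of_invariants [IsGalois k Ω] [Algebra k A] [IsScalarTower k Ω A]
    (hsemi : ∀ σ c, ρ σ (algebraMap Ω A c) = algebraMap Ω A (σ c))
    {ι : Type*} (b : ι → A) (hb : ∀ i σ, ρ σ (b i) = b i) (hli : LinearIndependent k b) :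
    LinearIndependent Ω b := by
  rw [linearIndependent_iff']
  intro s
  -- Artin's shortest-relation argument: with one coefficient scaled to 1, subtracting a relation
  -- from its conjugate shortens it. Hence all coefficients are Galois-fixed and lie in `k`.
  induction s using Finset.strongInduction with
  | H s ih =>
  intro g hg i hi
  by_contra hgi
  wlog h1 : g i = 1 generalizing g
  · refine this (fun j ↦ (g i)⁻¹ * g j) ?_ ?_ ?_
    · simp_rw [mul_smul, ← Finset.smul_sum, hg, smul_zero]
    · simp [hgi]
    · simp [hgi]
  classical
  have hfix (j : ι) (hj : j ∈ s) (σ : Ω ≃ₐ[k] Ω) : σ (g j) = g j := by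
    have hσ : ∑ j ∈ s, σ (g j) • b j = 0 := by
      have := congrArg (ρ σ) hg
      simp_rw [map_sum, Algebra.smul_def, map_mul, hsemi, hb, map_zero] at this
      simpa [Algebra.smul_def] using this
    have hsub : ∑ j ∈ s.erase i, (σ (g j) - g j) • b j = 0 := by
      rw [Finset.sum_erase]
      · simp_rw [sub_smul, Finset.sum_sub_distrib, hσ, hg, sub_zero]
      · simp [h1]
    by_cases hji : j = i
    · rw [hji, h1, map_one]
    · exact sub_eq_zero.mp
        (ih _ (Finset.erase_ssubset hi) _ hsub j (Finset.mem_erase.mpr ⟨hji, hj⟩))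
  have hk (j : ι) : ∃ c : k, j ∈ s → algebraMap k Ω c = g j := by
    by_cases hj : j ∈ s
    · obtain ⟨c, hc⟩ := IntermediateField.mem_bot.mp
        ((InfiniteGalois.mem_bot_iff_fixed (g j)).mpr (hfix j hj))
      exact ⟨c, fun _ ↦ hc⟩
    · exact ⟨0, fun h ↦ absurd h hj⟩
  choose c hc using hk
  have hc0 : ∑ j ∈ s, c j • b j = 0 := by
    rw [← hg]
    refine Finset.sum_congr rfl fun j hj ↦ ?_
    rw [← hc j hj, algebraMap_smul]
  have := linearIndependent_iff'.mp hli s c hc0 i hi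
  exact hgi (by rw [← hc i hi, this, map_zero])

end Algebra

/-- Galois descent for algebras: an `Ω`-algebra with a continuous semilinear action of
`Gal(Ω/k)` is the base change of its ring of invariants. -/
theorem isPushout_invariants {k Ω : Type u} [Field k] [Field Ω] [Algebra k Ω] [IsGalois k Ω]
    {A : Type u} [CommRing A] (f : Ω →+* A) (ρ : (Ω ≃ₐ[k] Ω) → A →+* A)
    (hmul : ∀ σ τ a, ρ (σ * τ) a = ρ σ (ρ τ a)) (hsemi : ∀ σ c, ρ σ (f c) = f (σ c))
    (hcont : ∀ a : A, ∃ L : IntermediateField k Ω, FiniteDimensional k L ∧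
      ∀ σ : Ω ≃ₐ[k] Ω, (∀ x ∈ L, σ x = x) → ρ σ a = a)
    (A₀ : Subring A) (hA₀ : ∀ a, a ∈ A₀ ↔ ∀ σ, ρ σ a = a) (g : k →+* A₀)
    (hg : ∀ c, (g c : A) = f (algebraMap k Ω c)) :
    IsPushout (CommRingCat.ofHom (algebraMap k Ω)) (CommRingCat.ofHom g)
      (CommRingCat.ofHom f) (CommRingCat.ofHom A₀.subtype) := by
  let : Algebra Ω A := f.toAlgebra
  let : Algebra k A₀ := g.toAlgebra
  let : Algebra k A := (f.comp (algebraMap k Ω)).toAlgebra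
  have : IsScalarTower k Ω A := .of_algebraMap_eq fun _ ↦ rfl
  have : IsScalarTower k A₀ A := .of_algebraMap_eq fun c ↦ (hg c).symm
  suffices Algebra.IsPushout k Ω A₀ A from CommRingCat.isPushout_of_isPushout k Ω A₀ A
  -- A `k`-basis of the invariants is also an `Ω`-basis of `A`, so $\Omega\otimes_k A_0\to A$
  -- carries a basis to a basis.
  let b := Module.Basis.ofVectorSpace k A₀
  have hli : LinearIndependent Ω fun i ↦ (b i : A) :=
    linearIndependent_of_invariants ρ hsemi _ (fun i ↦ (hA₀ _).mp (b i).2)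
      (b.linearIndependent.map' (IsScalarTower.toAlgHom k A₀ A).toLinearMap
        (LinearMap.ker_eq_bot.mpr Subtype.val_injective))
  have hspan : ⊤ ≤ Submodule.span Ω (Set.range fun i ↦ (b i : A)) := by
    intro a _
    obtain ⟨L, hL, ha⟩ := hcont a
    refine Submodule.span_le.mpr ?_ (mem_span_invariants ρ hmul hsemi L ha)
    intro x hx
    have h1 : (⟨x, (hA₀ x).mpr hx⟩ : A₀) ∈ Submodule.span k (Set.range b) := by
      rw [b.span_eq]
      trivial
    have h2 := Submodule.mem_map_of_mem (f := (IsScalarTower.toAlgHom k A₀ A).toLinearMap) h1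
    rw [Submodule.map_span, ← Set.range_comp] at h2
    exact Submodule.span_le_restrictScalars k Ω _ h2
  let b' : Module.Basis _ Ω A := .mk hli hspan
  refine ⟨IsBaseChange.of_equiv ((Algebra.TensorProduct.basis Ω b).equiv b' (Equiv.refl _)) ?_⟩
  intro x
  induction b.mem_span x using Submodule.span_induction with
  | mem x hx =>
    obtain ⟨i, rfl⟩ := hx
    rw [← Algebra.TensorProduct.basis_apply, Module.Basis.equiv_apply, Module.Basis.mk_apply]
    rfl
  | zero => simp
  | add x y _ _ hx hy => rw [TensorProduct.tmul_add, map_add, map_add, hx, hy]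
  | smul c x _ hx =>
    rw [TensorProduct.tmul_smul, LinearMap.map_smul, ← hx, ← algebraMap_smul Ω c, map_smul,
      algebraMap_smul]

/-! ### Semilinear actions on schemes and continuity of sections -/

lemma le_preimage_top {X Y : Scheme.{u}} (f : X ⟶ Y) (U : X.Opens) : U ≤ f ⁻¹ᵁ ⊤ :=
  fun _ _ ↦ trivial

/-- The action of `F` on the sections of an `F`-scheme over an open subset. -/
def structureHom {F : Type u} [Field F] {X : Scheme.{u}} (p : X ⟶ Spec (CommRingCat.of F))
    (U : X.Opens) : F →+* Γ(X, U) :=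
  ((Scheme.ΓSpecIso (CommRingCat.of F)).inv ≫ p.appLE ⊤ U (le_preimage_top p U)).hom

lemma structureHom_comp_appLE {F : Type u} [Field F] {X Y : Scheme.{u}}
    (p : Y ⟶ Spec (CommRingCat.of F)) (f : X ⟶ Y) {U : Y.Opens} {D : X.Opens} (h : D ≤ f ⁻¹ᵁ U) :
    CommRingCat.ofHom (structureHom p U) ≫ f.appLE U D h =
      CommRingCat.ofHom (structureHom (f ≫ p) D) := by
  simp only [structureHom, CommRingCat.ofHom_hom, Category.assoc]
  rw [Scheme.Hom.appLE_comp_appLE]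

lemma structureHom_comp_specMap {F L : Type u} [Field F] [Field L] {X : Scheme.{u}}
    (p : X ⟶ Spec (CommRingCat.of L)) (i : F →+* L) (U : X.Opens) :
    structureHom (p ≫ Spec.map (CommRingCat.ofHom i)) U = (structureHom p U).comp i := by
  refine congrArg CommRingCat.Hom.hom (?_ : (Scheme.ΓSpecIso (CommRingCat.of F)).inv ≫ _ =
    CommRingCat.ofHom i ≫ (Scheme.ΓSpecIso (CommRingCat.of L)).inv ≫ _)
  rw [Scheme.ΓSpecIso_inv_naturality_assoc, Scheme.Hom.appTop, Scheme.Hom.app_eq_appLE]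
  exact congrArg _ (Scheme.Hom.appLE_comp_appLE p _ ⊤ ⊤ U (le_preimage_top _ _)
    (le_preimage_top _ _)).symm

lemma toSpecΓ_specMap_structureHom {F : Type u} [Field F] {X : Scheme.{u}}
    (p : X ⟶ Spec (CommRingCat.of F)) (U : X.Opens) :
    U.toSpecΓ ≫ Spec.map (CommRingCat.ofHom (structureHom p U)) = U.ι ≫ p := by
  rw [structureHom, CommRingCat.ofHom_hom, Spec.map_comp, Scheme.Opens.toSpecΓ_SpecMap_appLE_assoc,
    Scheme.Opens.toSpecΓ_top, Category.assoc, toSpecΓ_SpecMap_ΓSpecIso_inv, Category.comp_id]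
  simp

/-- A semilinear action of `Gal(Ω/k)` on an `Ω`-scheme `p : X ⟶ Spec Ω`. -/
structure SemilinearAction (k : Type u) {Ω : Type u} [Field k] [Field Ω] [Algebra k Ω]
    {X : Scheme.{u}} (p : X ⟶ Spec (CommRingCat.of Ω)) where
  act (σ : Ω ≃ₐ[k] Ω) : X ⟶ X
  act_mul (σ τ : Ω ≃ₐ[k] Ω) : act (σ * τ) = act σ ≫ act τ
  act_comp (σ : Ω ≃ₐ[k] Ω) : act σ ≫ p = p ≫ Spec.map (CommRingCat.ofHom (σ : Ω →+* Ω))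

namespace SemilinearAction

variable {k Ω : Type u} [Field k] [Field Ω] [Algebra k Ω] {X : Scheme.{u}}
  {p : X ⟶ Spec (CommRingCat.of Ω)} (a : SemilinearAction k p)

lemma appLE_structureHom {U D : X.Opens} (σ : Ω ≃ₐ[k] Ω) (h : D ≤ a.act σ ⁻¹ᵁ U) (c : Ω) :
    (a.act σ).appLE U D h (structureHom p U c) = structureHom p D (σ c) := by
  have := structureHom_comp_appLE p (a.act σ) h
  rw [a.act_comp, structureHom_comp_specMap] at this
  exact congr($(this).hom c)

/-- A section is continuous if it is fixed by an open subgroup of `Gal(Ω/k)`. -/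
def IsContinuousSection {U : X.Opens} (s : Γ(X, U)) : Prop :=
  ∃ L : IntermediateField k Ω, FiniteDimensional k L ∧ ∀ σ : Ω ≃ₐ[k] Ω, (∀ x ∈ L, σ x = x) →
    ∃ h : U ≤ a.act σ ⁻¹ᵁ U, (a.act σ).appLE U U h s = s

-- Quantifying over all ring endomorphisms that fix `s` and `t` gives closure under every ring
-- operation at once; the compositum of two finite extensions is finite.
variable {a} in
lemma IsContinuousSection.map₂ {U : X.Opens} {s t r : Γ(X, U)} (hs : a.IsContinuousSection s)
    (ht : a.IsContinuousSection t)
    (H : ∀ f : Γ(X, U) →+* Γ(X, U), f s = s → f t = t → f r = r) : a.IsContinuousSection r := by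
  obtain ⟨L, hL, h⟩ := hs
  obtain ⟨L', hL', h'⟩ := ht
  refine ⟨L ⊔ L', inferInstance, fun σ hσ ↦ ?_⟩
  obtain ⟨h₁, h₂⟩ := h σ fun x hx ↦ hσ x (le_sup_left (a := L) hx)
  obtain ⟨h₁', h₂'⟩ := h' σ fun x hx ↦ hσ x (le_sup_right (a := L) hx)
  exact ⟨h₁, H ((a.act σ).appLE U U h₁).hom h₂ h₂'⟩

/-- If `X` comes from a scheme `Y` over a finite extension `K` of `k` such that `Gal(Ω/K)` acts
trivially on `Y`, then all sections over the preimage of an affine open of `Y` are continuous. -/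
lemma isContinuousSection_preimage [Algebra.IsAlgebraic k Ω] (K : IntermediateField k Ω)
    [FiniteDimensional k K] {Y : Scheme.{u}} {q : Y ⟶ Spec (CommRingCat.of K)} {π : X ⟶ Y}
    (H : IsPullback π p q (Spec.map (CommRingCat.ofHom (algebraMap K Ω))))
    (hπ : ∀ σ : Ω ≃ₐ[k] Ω, (∀ x ∈ K, σ x = x) → a.act σ ≫ π = π)
    {W : Y.Opens} (hW : IsAffineOpen W) (s : Γ(X, π ⁻¹ᵁ W)) : a.IsContinuousSection s := by
  have hinv (σ : Ω ≃ₐ[k] Ω) (hσ : ∀ x ∈ K, σ x = x) : π ⁻¹ᵁ W ≤ a.act σ ⁻¹ᵁ π ⁻¹ᵁ W := by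
    rw [← Scheme.Hom.comp_preimage, hπ σ hσ]
  have hY (b : Γ(Y, W)) : a.IsContinuousSection (π.app W b) := by
    refine ⟨K, inferInstance, fun σ hσ ↦ ⟨hinv σ hσ, ?_⟩⟩
    rw [← CommRingCat.comp_apply, Scheme.Hom.app_eq_appLE, Scheme.Hom.appLE_comp_appLE]
    simp only [hπ σ hσ]
  have hΩ (c : Ω) : a.IsContinuousSection (structureHom p (π ⁻¹ᵁ W) c) := by
    have : FiniteDimensional k (IntermediateField.adjoin k {c}) :=
      IntermediateField.adjoin.finiteDimensional (Algebra.IsIntegral.isIntegral c)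
    refine ⟨K ⊔ IntermediateField.adjoin k {c}, inferInstance, fun σ hσ ↦ ⟨hinv σ fun x hx ↦
      hσ x (le_sup_left (a := K) hx), ?_⟩⟩
    rw [appLE_structureHom, hσ c (le_sup_right (a := K)
      (IntermediateField.mem_adjoin_simple_self k c))]
  let S : Subring Γ(X, π ⁻¹ᵁ W) :=
    { carrier := {s | a.IsContinuousSection s}
      mul_mem' hx hy := hx.map₂ hy fun f h h' ↦ by rw [map_mul, h, h']
      -- The constant 0 is only a filler for the two arguments of `map₂`.
      one_mem' := (hΩ 0).map₂ (hΩ 0) fun f _ _ ↦ map_one f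
      add_mem' hx hy := hx.map₂ hy fun f h h' ↦ by rw [map_add, h, h']
      zero_mem' := (hΩ 0).map₂ (hΩ 0) fun f _ _ ↦ map_zero f
      neg_mem' hx := hx.map₂ hx fun f h _ ↦ by rw [map_neg, h] }
  -- The sections over the preimage of `W` are the pushout of those over `W` and of `Ω`. Both land
  -- in `S`, so the inclusion of `S` has a right inverse and `S` is everything.
  have hP := (isIso_pushoutSection_iff H (US := ⊤) (UT := ⊤) (UX := W) (UY := π ⁻¹ᵁ W)
    (by simp) (by simp) (by simp)).mp (isIso_pushoutSection_of_isAffineOpen H _ _ _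
      (isAffineOpen_top _) (isAffineOpen_top _) hW)
  let i : CommRingCat.of S ⟶ Γ(X, π ⁻¹ᵁ W) := CommRingCat.ofHom S.subtype
  let l : Γ(Y, W) ⟶ CommRingCat.of S :=
    CommRingCat.ofHom ((π.appLE W (π ⁻¹ᵁ W) le_rfl).hom.codRestrict S fun b ↦ by
      rw [Scheme.Hom.appLE_eq_app]
      exact hY b)
  let r : Γ(Spec (CommRingCat.of Ω), ⊤) ⟶ CommRingCat.of S :=
    (Scheme.ΓSpecIso (CommRingCat.of Ω)).hom ≫
      CommRingCat.ofHom ((structureHom p (π ⁻¹ᵁ W)).codRestrict S hΩ)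
  have hl : l ≫ i = π.appLE W (π ⁻¹ᵁ W) le_rfl := rfl
  have hr : r ≫ i = p.appLE ⊤ (π ⁻¹ᵁ W) (by simp) := by
    have : CommRingCat.ofHom ((structureHom p (π ⁻¹ᵁ W)).codRestrict S hΩ) ≫ i =
        (Scheme.ΓSpecIso (CommRingCat.of Ω)).inv ≫ p.appLE ⊤ (π ⁻¹ᵁ W) (by simp) := by
      ext c
      rfl
    refine (Category.assoc _ _ _).trans ((congrArg _ this).trans ?_)
    exact Iso.hom_inv_id_assoc (Scheme.ΓSpecIso (CommRingCat.of Ω)) _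
  have : Mono i := ConcreteCategory.mono_of_injective _ Subtype.val_injective
  have hw : q.appLE ⊤ W (by simp) ≫ l =
      (Spec.map (CommRingCat.ofHom (algebraMap K Ω))).appLE ⊤ ⊤ (by simp) ≫ r := by
    rw [← cancel_mono i, Category.assoc, Category.assoc, hl, hr]
    exact hP.w
  have hid : hP.desc l r hw ≫ i = 𝟙 _ := by
    apply hP.hom_ext
    · rw [hP.inl_desc_assoc, hl, Category.comp_id]
    · rw [hP.inr_desc_assoc, hr, Category.comp_id]
  rw [← show (hP.desc l r hw ≫ i) s = s by rw [hid]; rfl]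
  exact (hP.desc l r hw s).2

/-- If all sections over an affine open `D` are continuous, so are all sections over a basic open
subset of `D`. -/
lemma isContinuousSection_basicOpen {D : X.Opens} (hD : IsAffineOpen D)
    (H : ∀ s : Γ(X, D), a.IsContinuousSection s) (f : Γ(X, D)) (s : Γ(X, X.basicOpen f)) :
    a.IsContinuousSection s := by
  have := hD.isLocalization_basicOpen f
  obtain ⟨⟨g, ⟨_, n, rfl⟩⟩, hg⟩ := IsLocalization.surj (Submonoid.powers f) s
  obtain ⟨L, hL, h⟩ := H f
  obtain ⟨L', hL', h'⟩ := H g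
  refine ⟨L ⊔ L', inferInstance, fun σ hσ ↦ ?_⟩
  obtain ⟨h₁, h₂⟩ := h σ fun x hx ↦ hσ x (le_sup_left (a := L) hx)
  obtain ⟨h₁', h₂'⟩ := h' σ fun x hx ↦ hσ x (le_sup_right (a := L) hx)
  have hle : X.basicOpen f ≤ a.act σ ⁻¹ᵁ X.basicOpen f := by
    have := Scheme.basicOpen_appLE (a.act σ) D D h₁ f
    rw [h₂] at this
    exact this.le.trans inf_le_right
  refine ⟨hle, ?_⟩
  have hres (t : Γ(X, D)) (ht : (a.act σ).appLE D D h₁ t = t) :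
      (a.act σ).appLE _ _ hle (algebraMap Γ(X, D) Γ(X, X.basicOpen f) t) =
        algebraMap Γ(X, D) Γ(X, X.basicOpen f) t := by
    change (X.presheaf.map _ ≫ (a.act σ).appLE _ _ hle) t = X.presheaf.map _ t
    rw [Scheme.Hom.map_appLE]
    conv_rhs => rw [← ht]
    rw [← CommRingCat.comp_apply, Scheme.Hom.appLE_map]
  have hu : IsUnit (algebraMap Γ(X, D) Γ(X, X.basicOpen f) (f ^ n)) :=
    IsLocalization.map_units _ (⟨f ^ n, n, rfl⟩ : Submonoid.powers f)
  -- Both `f ^ n` and `g` are fixed in `s * f ^ n = g`, and `f ^ n` is a unit.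
  have key := congrArg ((a.act σ).appLE _ _ hle).hom hg
  rw [map_mul] at key
  simp only [] at key hg
  rw [hres _ h₂', hres _ (by rw [map_pow, h₂]), ← hg] at key
  exact hu.mul_right_cancel key

/-- `U` need not be a preimage from `Y`, so continuity is known only on small basic opens. As `U` is
invariant, equality of a section with its conjugate is local on `U`, and compactness leaves finitely
many fields to join. -/
lemma isContinuousSection_of_isCompact [Algebra.IsAlgebraic k Ω] (K : IntermediateField k Ω)
    [FiniteDimensional k K] {Y : Scheme.{u}} {q : Y ⟶ Spec (CommRingCat.of K)} {π : X ⟶ Y}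
    (H : IsPullback π p q (Spec.map (CommRingCat.ofHom (algebraMap K Ω))))
    (hπ : ∀ σ : Ω ≃ₐ[k] Ω, (∀ x ∈ K, σ x = x) → a.act σ ≫ π = π)
    {U : X.Opens} (hU : IsCompact (U : Set X)) (hinv : ∀ σ, U ≤ a.act σ ⁻¹ᵁ U) (s : Γ(X, U)) :
    a.IsContinuousSection s := by
  suffices ∃ L : IntermediateField k Ω, FiniteDimensional k L ∧
      ∀ σ : Ω ≃ₐ[k] Ω, (∀ x ∈ L, σ x = x) → ∀ x ∈ (U : Set X), ∃ (D : X.Opens) (hD : D ≤ U),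
        x ∈ D ∧ X.presheaf.map (homOfLE hD).op ((a.act σ).appLE U U (hinv σ) s) =
          X.presheaf.map (homOfLE hD).op s by
    obtain ⟨L, hL, h⟩ := this
    exact ⟨L, hL, fun σ hσ ↦ ⟨hinv σ, TopCat.Presheaf.IsSheaf.section_ext X.sheaf.2 (h σ hσ)⟩⟩
  refine hU.induction_on ⟨⊥, inferInstance, by simp⟩ ?_ ?_ ?_
  · rintro s t hst ⟨L, hL, h⟩
    exact ⟨L, hL, fun σ hσ x hx ↦ h σ hσ x (hst hx)⟩
  · rintro s t ⟨L, hL, h⟩ ⟨L', hL', h'⟩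
    refine ⟨L ⊔ L', inferInstance, fun σ hσ x hx ↦ ?_⟩
    rcases hx with hx | hx
    · exact h σ (fun x hx ↦ hσ x (le_sup_left (a := L) hx)) x hx
    · exact h' σ (fun x hx ↦ hσ x (le_sup_right (a := L) hx)) x hx
  · intro x hx
    obtain ⟨W, hW, hxW, -⟩ :=
      exists_isAffineOpen_mem_and_subset (X := Y) (x := π x) (U := ⊤) trivial
    have : IsAffineHom π :=
      MorphismProperty.of_isPullback (P := @IsAffineHom) H.flip inferInstance
    have hD := hW.preimage π
    obtain ⟨f, hf, hxf⟩ := hD.exists_basicOpen_le (V := U) ⟨x, hx⟩ hxW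
    obtain ⟨L, hL, h⟩ := a.isContinuousSection_basicOpen hD
      (a.isContinuousSection_preimage K H hπ hW) f (X.presheaf.map (homOfLE hf).op s)
    refine ⟨X.basicOpen f, mem_nhdsWithin_of_mem_nhds ((X.basicOpen f).isOpen.mem_nhds hxf),
      L, hL, fun σ hσ y hy ↦ ⟨X.basicOpen f, hf, hy, ?_⟩⟩
    obtain ⟨h₁, h₂⟩ := h σ hσ
    rw [← h₂, ← CommRingCat.comp_apply, ← CommRingCat.comp_apply, Scheme.Hom.appLE_map,
      Scheme.Hom.map_appLE]

end SemilinearAction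

/-! ### Gluing descended charts -/

section Gluing

variable {X S T : Scheme.{u}} {f : T ⟶ S} {p : X ⟶ T} {P : X.Opens → Prop}
  {G : {U // P U} ⥤ Scheme.{u}} {b : ∀ U, G.obj U ⟶ S}
  {c : ∀ U : {U // P U}, U.1.toScheme ⟶ G.obj U}

lemma exists_ι_eq (U : X.Opens) {x : X} (hx : x ∈ U) : ∃ y : U.toScheme, U.ι y = x :=
  ⟨⟨x, hx⟩, rfl⟩

/-- Pasting law: the squares of `U` and of `W` over `f` are both cartesian. -/
lemma isPullback_transition (hb : ∀ {U W : {U // P U}} (i : U ⟶ W), G.map i ≫ b W = b U)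
    (hc : ∀ {U W : {U // P U}} (i : U ⟶ W), X.homOfLE (leOfHom i) ≫ c W = c U ≫ G.map i)
    (H : ∀ U, IsPullback (c U) (U.1.ι ≫ p) (b U) f) {U W : {U // P U}} (i : U ⟶ W) :
    IsPullback (c U) (X.homOfLE (leOfHom i)) (G.map i) (c W) := by
  refine .of_bot ?_ (hc i).symm (H W)
  rw [hb, Scheme.homOfLE_ι_assoc]
  exact H U

/-- Gluing of quotients: if opens of `X` that cover `X` and are stable under intersection descend
compatibly along an fpqc morphism `f : T ⟶ S`, then `X` descends. -/
theorem exists_isPullback_of_charts [Flat f] [Surjective f] [QuasiCompact f]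
    (hcov : ∀ x : X, ∃ U, P U ∧ x ∈ U) (hinf : ∀ U W, P U → P W → P (U ⊓ W))
    (hb : ∀ {U W : {U // P U}} (i : U ⟶ W), G.map i ≫ b W = b U)
    (hc : ∀ {U W : {U // P U}} (i : U ⟶ W), X.homOfLE (leOfHom i) ≫ c W = c U ≫ G.map i)
    (H : ∀ U, IsPullback (c U) (U.1.ι ≫ p) (b U) f) :
    ∃ (Y : Scheme.{u}) (q : Y ⟶ S) (π : X ⟶ Y) (g : ∀ U, G.obj U ⟶ Y),
      IsPullback π p q f ∧ ∀ U, U.1.ι ≫ π = c U ≫ g U := by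
  have sq {U W : {U // P U}} (i : U ⟶ W) := isPullback_transition hb hc H i
  have hfpqc (U : {U // P U}) :
      (@Surjective ⊓ @Flat ⊓ @QuasiCompact : MorphismProperty Scheme) (c U) :=
    ⟨⟨MorphismProperty.of_isPullback (H U).flip ‹_›, MorphismProperty.of_isPullback (H U).flip ‹_›⟩,
      MorphismProperty.of_isPullback (H U).flip ‹_›⟩
  have hsurj (U : {U // P U}) : Surjective (c U) := (hfpqc U).1.1
  have hopen {U W : {U // P U}} (i : U ⟶ W) : IsOpenImmersion (G.map i) :=
    MorphismProperty.of_isPullback_of_descendsAlong (P := @IsOpenImmersion) (sq i).flip (hfpqc W)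
      inferInstance
  -- Points of two charts that agree in a third lift to one point of `X`, which lies in the
  -- intersection of the two opens; that intersection is again a chart.
  have hdir : (G ⋙ Scheme.forget).IsLocallyDirected := by
    refine ⟨fun {i j k} fi fj xi xj heq ↦ ?_⟩
    obtain ⟨u, rfl⟩ := (c i).surjective xi
    have h1 : G.map fj xj = c k (X.homOfLE (leOfHom fi) u) := by
      rw [← Scheme.Hom.comp_apply, hc, Scheme.Hom.comp_apply]
      exact heq.symm
    obtain ⟨v, rfl, hv⟩ := Scheme.exists_preimage_of_isPullback (sq fj) xj _ h1
    have huv : j.1.ι v = i.1.ι u := by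
      have := congrArg k.1.ι hv
      rwa [← Scheme.Hom.comp_apply, ← Scheme.Hom.comp_apply, Scheme.homOfLE_ι,
        Scheme.homOfLE_ι] at this
    have hmem : i.1.ι u ∈ i.1 ⊓ j.1 := ⟨u.2, huv ▸ v.2⟩
    let l : {U // P U} := ⟨i.1 ⊓ j.1, hinf _ _ i.2 j.2⟩
    let li : l ⟶ i := homOfLE (show i.1 ⊓ j.1 ≤ i.1 from inf_le_left)
    let lj : l ⟶ j := homOfLE (show i.1 ⊓ j.1 ≤ j.1 from inf_le_right)
    obtain ⟨w, hw⟩ := exists_ι_eq l.1 hmem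
    have hwi : X.homOfLE (leOfHom li) w = u :=
      i.1.ι.injective (by rw [← Scheme.Hom.comp_apply, Scheme.homOfLE_ι, hw])
    have hwj : X.homOfLE (leOfHom lj) w = v :=
      j.1.ι.injective (by rw [← Scheme.Hom.comp_apply, Scheme.homOfLE_ι, hw, huv])
    refine ⟨l, li, lj, c l w, ?_, ?_⟩
    · change G.map li (c l w) = c i u
      rw [← Scheme.Hom.comp_apply, ← hc, Scheme.Hom.comp_apply, hwi]
    · change G.map lj (c l w) = c j v
      rw [← Scheme.Hom.comp_apply, ← hc, Scheme.Hom.comp_apply, hwj]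
  let 𝒰 : X.OpenCover := X.openCoverOfIsOpenCover (fun U : {U // P U} ↦ U.1) <| by
    refine top_le_iff.mp fun x _ ↦ ?_
    obtain ⟨U, hU, hx⟩ := hcov x
    exact TopologicalSpace.Opens.mem_iSup.mpr ⟨⟨U, hU⟩, hx⟩
  let q : colimit G ⟶ S := colimit.desc G
    { pt := S
      ι := { app := b, naturality := fun U W i ↦ (hb i).trans (Category.comp_id _).symm } }
  have hq (U : {U // P U}) : colimit.ι G U ≫ q = b U := colimit.ι_desc _ _
  let π : X ⟶ colimit G := 𝒰.glueMorphisms (fun U ↦ c U ≫ colimit.ι G U)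
      fun (U W : {U // P U}) ↦ by
    let l : {U // P U} := ⟨U.1 ⊓ W.1, hinf _ _ U.2 W.2⟩
    let lU : l ⟶ U := homOfLE (show U.1 ⊓ W.1 ≤ U.1 from inf_le_left)
    let lW : l ⟶ W := homOfLE (show U.1 ⊓ W.1 ≤ W.1 from inf_le_right)
    refine (cancel_epi (isPullback_opens_inf U.1 W.1).isoPullback.hom).mp ?_
    refine ((isPullback_opens_inf U.1 W.1).isoPullback_hom_fst_assoc _).trans (Eq.trans ?_
      ((isPullback_opens_inf U.1 W.1).isoPullback_hom_snd_assoc _).symm)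
    have h1 := hc lU =≫ colimit.ι G U
    have h2 := hc lW =≫ colimit.ι G W
    rw [Category.assoc, Category.assoc, colimit.w] at h1 h2
    exact h1.trans h2.symm
  have hπ (U : {U // P U}) : U.1.ι ≫ π = c U ≫ colimit.ι G U := 𝒰.ι_glueMorphisms _ _ U
  have hπq : π ≫ q = p ≫ f := by
    refine 𝒰.hom_ext _ _ fun (U : {U // P U}) ↦ ?_
    change U.1.ι ≫ π ≫ q = U.1.ι ≫ p ≫ f
    rw [reassoc_of% hπ, hq, (H U).w, Category.assoc]
  let h : X ⟶ pullback q f := pullback.lift π p hπq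
  have sqh (U : {U // P U}) :
      IsPullback (c U) (U.1.ι ≫ h) (colimit.ι G U) (pullback.fst q f) := by
    refine .of_bot ?_ ?_ (.of_hasPullback q f)
    · rw [Category.assoc, pullback.lift_snd, hq]
      exact H U
    · rw [Category.assoc, pullback.lift_fst, hπ]
  have hoi (U : {U // P U}) : IsOpenImmersion (U.1.ι ≫ h) :=
    MorphismProperty.of_isPullback (sqh U) inferInstance
  -- Points with the same image come from a common smaller chart `k`, on which `h` restricts to an
  -- open immersion.
  have hinj : Function.Injective h := by
    intro x y hxy
    obtain ⟨U, hU, hxU⟩ := hcov x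
    obtain ⟨W, hW, hyW⟩ := hcov y
    obtain ⟨x, rfl⟩ := exists_ι_eq U hxU
    obtain ⟨y, rfl⟩ := exists_ι_eq W hyW
    have heq : colimit.ι G ⟨U, hU⟩ (c ⟨U, hU⟩ x) = colimit.ι G ⟨W, hW⟩ (c ⟨W, hW⟩ y) := by
      rw [← Scheme.Hom.comp_apply, ← Scheme.Hom.comp_apply, ← hπ, ← hπ,
        show π = h ≫ pullback.fst q f from (pullback.lift_fst _ _ _).symm]
      exact congrArg (pullback.fst q f) hxy
    obtain ⟨k, fi, fj, z, hzi, hzj⟩ := (Scheme.IsLocallyDirected.ι_eq_ι_iff G).mp heq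
    obtain ⟨x', -, hx'⟩ := Scheme.exists_preimage_of_isPullback (sq fi) z x hzi
    obtain ⟨y', -, hy'⟩ := Scheme.exists_preimage_of_isPullback (sq fj) z y hzj
    have hx : k.1.ι x' = U.ι x := by
      have := congrArg (Scheme.Opens.ι U) hx'
      rwa [← Scheme.Hom.comp_apply, Scheme.homOfLE_ι] at this
    have hy : k.1.ι y' = W.ι y := by
      have := congrArg (Scheme.Opens.ι W) hy'
      rwa [← Scheme.Hom.comp_apply, Scheme.homOfLE_ι] at this
    have hxy' : (k.1.ι ≫ h) x' = (k.1.ι ≫ h) y' := by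
      rw [Scheme.Hom.comp_apply, Scheme.Hom.comp_apply, hx, hy, hxy]
    rw [← hx, ← hy, (k.1.ι ≫ h).injective hxy']
  have hsur : Surjective h := by
    refine ⟨fun z ↦ ?_⟩
    obtain ⟨U, w, hw⟩ := Scheme.IsLocallyDirected.ι_jointly_surjective G (pullback.fst q f z)
    obtain ⟨x, -, hx⟩ := Scheme.exists_preimage_of_isPullback (sqh U) w z hw
    exact ⟨U.1.ι x, hx⟩
  have hop : IsOpenImmersion h := .of_openCover_source h 𝒰 hinj hoi
  have : IsIso h := (isIso_iff_isOpenImmersion_and_surjective h).mpr ⟨hop, hsur⟩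
  refine ⟨colimit G, q, π, colimit.ι G, ?_, hπ⟩
  exact .of_iso_pullback ⟨hπq⟩ (asIso h) (pullback.lift_fst _ _ _) (pullback.lift_snd _ _ _)

end Gluing

lemma faithfullyFlat_specMap (K Ω : Type u) [Field K] [Field Ω] [Algebra K Ω] :
    Flat (Spec.map (CommRingCat.ofHom (algebraMap K Ω))) ∧
      Surjective (Spec.map (CommRingCat.ofHom (algebraMap K Ω))) :=
  (flat_and_surjective_SpecMap_iff _).mpr (RingHom.faithfullyFlat_algebraMap_iff.mpr inferInstance)

/-! ### The quotient by a continuous semilinear action -/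

namespace SemilinearAction

variable {k Ω : Type u} [Field k] [Field Ω] [Algebra k Ω] {X : Scheme.{u}}
  {p : X ⟶ Spec (CommRingCat.of Ω)} (a : SemilinearAction k p)

/-- The ring of invariant sections over an open subset. -/
def invariants (U : X.Opens) : Subring Γ(X, U) where
  carrier := {s | ∀ (σ : Ω ≃ₐ[k] Ω) (h : U ≤ a.act σ ⁻¹ᵁ U), (a.act σ).appLE U U h s = s}
  mul_mem' hx hy σ h := by rw [map_mul, hx σ h, hy σ h]
  one_mem' σ h := map_one _
  add_mem' hx hy σ h := by rw [map_add, hx σ h, hy σ h]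
  zero_mem' σ h := map_zero _
  neg_mem' hx σ h := by rw [map_neg, hx σ h]

/-- Invariant affine open subschemes. -/
def IsInvariantAffine (U : X.Opens) : Prop :=
  IsAffineOpen U ∧ ∀ σ, U ≤ a.act σ ⁻¹ᵁ U

lemma map_mem_invariants {U W : X.Opens} (hW : ∀ σ, W ≤ a.act σ ⁻¹ᵁ W) (i : U ≤ W) {s : Γ(X, W)}
    (hs : s ∈ a.invariants W) : X.presheaf.map (homOfLE i).op s ∈ a.invariants U := by
  intro σ h
  rw [← CommRingCat.comp_apply, Scheme.Hom.map_appLE]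
  conv_rhs => rw [← hs σ (hW σ)]
  rw [← CommRingCat.comp_apply, Scheme.Hom.appLE_map]

lemma structureHom_algebraMap_mem_invariants (U : X.Opens) (c : k) :
    structureHom p U (algebraMap k Ω c) ∈ a.invariants U := by
  intro σ h
  rw [a.appLE_structureHom, AlgEquiv.commutes]

/-- Restriction of invariant sections. -/
def restrictInvariants {U W : {U // a.IsInvariantAffine U}} (i : U ⟶ W) :
    a.invariants W.1 →+* a.invariants U.1 :=
  ((X.presheaf.map (homOfLE (leOfHom i)).op).hom.comp (a.invariants W.1).subtype).codRestrict _
    fun s ↦ a.map_mem_invariants W.2.2 (leOfHom i) s.2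

/-- The spectra of the rings of invariants of the invariant affine opens. -/
def quotientFunctor : {U // a.IsInvariantAffine U} ⥤ Scheme.{u} where
  obj U := Spec (CommRingCat.of (a.invariants U.1))
  map i := Spec.map (CommRingCat.ofHom (a.restrictInvariants i))
  map_id U := by
    rw [← Spec.map_id]
    congr 1
    ext s
    exact congr($(X.presheaf.map_id (Opposite.op U.1)).hom s.1)
  map_comp {U V W} i j := by
    rw [← Spec.map_comp]
    congr 1
    ext s
    exact congr($(X.presheaf.map_comp (homOfLE (leOfHom j) : V.1 ⟶ W.1).op
      (homOfLE (leOfHom i) : U.1 ⟶ V.1).op).hom s.1)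

/-- The quotient map of an invariant affine open. -/
def quotientMap (U : {U // a.IsInvariantAffine U}) :
    U.1.toScheme ⟶ Spec (CommRingCat.of (a.invariants U.1)) :=
  U.1.toSpecΓ ≫ Spec.map (CommRingCat.ofHom (a.invariants U.1).subtype)

/-- The structure morphism of the quotient of an invariant affine open. -/
def quotientBase (U : {U // a.IsInvariantAffine U}) :
    Spec (CommRingCat.of (a.invariants U.1)) ⟶ Spec (CommRingCat.of k) :=
  Spec.map (CommRingCat.ofHom (((structureHom p U.1).comp (algebraMap k Ω)).codRestrict
    (a.invariants U.1) (a.structureHom_algebraMap_mem_invariants U.1)))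

lemma specMap_restrictInvariants_quotientBase {U W : {U // a.IsInvariantAffine U}} (i : U ⟶ W) :
    Spec.map (CommRingCat.ofHom (a.restrictInvariants i)) ≫ a.quotientBase W =
      a.quotientBase U := by
  rw [quotientBase, quotientBase, ← Spec.map_comp]
  congr 1
  ext c
  change (p.appLE ⊤ W.1 (le_preimage_top p W.1) ≫
      X.presheaf.map (homOfLE (leOfHom i) : U.1 ⟶ W.1).op)
    ((Scheme.ΓSpecIso (CommRingCat.of Ω)).inv (algebraMap k Ω c)) = _
  rw [Scheme.Hom.appLE_map]
  rfl

lemma homOfLE_quotientMap {U W : {U // a.IsInvariantAffine U}} (i : U ⟶ W) :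
    X.homOfLE (leOfHom i) ≫ a.quotientMap W =
      a.quotientMap U ≫ Spec.map (CommRingCat.ofHom (a.restrictInvariants i)) := by
  rw [quotientMap, ← Scheme.Opens.toSpecΓ_SpecMap_presheaf_map_assoc, quotientMap, Category.assoc,
    ← Spec.map_comp, ← Spec.map_comp]
  rfl

lemma act_resLE_quotientMap (U : {U // a.IsInvariantAffine U}) (σ : Ω ≃ₐ[k] Ω) :
    (a.act σ).resLE U.1 U.1 (U.2.2 σ) ≫ a.quotientMap U = a.quotientMap U := by
  rw [quotientMap, ← Scheme.Opens.toSpecΓ_SpecMap_appLE_assoc, ← Spec.map_comp]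
  congr 2
  ext s
  exact s.2 σ (U.2.2 σ)

lemma isPullback_quotientMap [IsGalois k Ω]
    (hcont : ∀ U, a.IsInvariantAffine U → ∀ s : Γ(X, U), a.IsContinuousSection s)
    (U : {U // a.IsInvariantAffine U}) :
    IsPullback (a.quotientMap U) (U.1.ι ≫ p) (a.quotientBase U)
      (Spec.map (CommRingCat.ofHom (algebraMap k Ω))) := by
  have h := isPullback_SpecMap_of_isPushout _ _ _ _ (isPushout_invariants (structureHom p U.1)
    (fun σ ↦ ((a.act σ).appLE U.1 U.1 (U.2.2 σ)).hom)
    (fun σ τ s ↦ by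
      -- Pulling back sections reverses composition: `act σ ≫ act τ` acts on sections by `τ` and
      -- then by `σ`.
      change _ = ((a.act τ).appLE _ _ (U.2.2 τ) ≫ (a.act σ).appLE _ _ (U.2.2 σ)) s
      rw [Scheme.Hom.appLE_comp_appLE]
      simp only [a.act_mul])
    (fun σ c ↦ a.appLE_structureHom σ _ c)
    (fun s ↦ by
      obtain ⟨L, hL, h⟩ := hcont U.1 U.2 s
      exact ⟨L, hL, fun σ hσ ↦ (h σ hσ).2⟩)
    (a.invariants U.1) (fun s ↦ ⟨fun h σ ↦ h σ _, fun h σ _ ↦ h σ⟩)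
    (((structureHom p U.1).comp (algebraMap k Ω)).codRestrict
      (a.invariants U.1) (a.structureHom_algebraMap_mem_invariants U.1)) fun c ↦ rfl)
  refine h.flip.of_iso U.2.1.isoSpec.symm (Iso.refl _) (Iso.refl _) (Iso.refl _) ?_ ?_ ?_ ?_
  · rw [Iso.refl_hom, Category.comp_id, Iso.symm_hom, quotientMap,
      IsAffineOpen.isoSpec_inv_toSpecΓ_assoc]
  · rw [Iso.refl_hom, Category.comp_id, Iso.symm_hom, ← toSpecΓ_specMap_structureHom,
      IsAffineOpen.isoSpec_inv_toSpecΓ_assoc]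
  · exact (Category.comp_id _).trans (Category.id_comp _).symm
  · exact (Category.comp_id _).trans (Category.id_comp _).symm

lemma IsInvariantAffine.inf [IsSeparated p] {a : SemilinearAction k p} {U W : X.Opens}
    (hU : a.IsInvariantAffine U) (hW : a.IsInvariantAffine W) : a.IsInvariantAffine (U ⊓ W) := by
  have : X.IsSeparated := ⟨by
    rw [terminal.hom_ext (terminal.from X) (p ≫ terminal.from _)]
    infer_instance⟩
  exact ⟨IsAffineOpen.inf hU.1 hW.1, fun σ ↦ inf_le_inf (hU.2 σ) (hW.2 σ)⟩

/-- A continuous semilinear Galois action with enough invariant affine opens has a quotient, of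
which the scheme is the base change. -/
theorem exists_quotient [IsGalois k Ω] [IsSeparated p]
    (hcont : ∀ U, a.IsInvariantAffine U → ∀ s : Γ(X, U), a.IsContinuousSection s)
    (hcov : ∀ x : X, ∃ U, a.IsInvariantAffine U ∧ x ∈ U) :
    ∃ (Y : Scheme.{u}) (q : Y ⟶ Spec (CommRingCat.of k)) (π : X ⟶ Y),
      IsPullback π p q (Spec.map (CommRingCat.ofHom (algebraMap k Ω))) ∧
        ∀ σ, a.act σ ≫ π = π := by
  have := (faithfullyFlat_specMap k Ω).1
  have := (faithfullyFlat_specMap k Ω).2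
  obtain ⟨Y, q, π, g, h, hg⟩ := exists_isPullback_of_charts (G := a.quotientFunctor)
    (b := a.quotientBase) (c := a.quotientMap) hcov (fun U W hU hW ↦ hU.inf hW)
    a.specMap_restrictInvariants_quotientBase a.homOfLE_quotientMap (a.isPullback_quotientMap hcont)
  refine ⟨Y, q, π, h, fun σ ↦ Scheme.hom_ext_of_forall _ _ fun x ↦ ?_⟩
  obtain ⟨U, hU, hx⟩ := hcov x
  refine ⟨U, hx, ?_⟩
  have h1 := Scheme.Hom.resLE_comp_ι_assoc (a.act σ) (hU.2 σ) π
  rw [← h1, hg ⟨U, hU⟩]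
  exact (reassoc_of% (a.act_resLE_quotientMap ⟨U, hU⟩ σ)) _

end SemilinearAction

/-! ### Descent systems as semilinear actions, and descent of properties -/

lemma baseChange_map_proj {F L : Type u} [Field F] [Field L] (i : F →+* L) {V W : SchemesOver F}
    (α : V ⟶ W) : ((baseChange i).map α).left ≫ proj i W = proj i V ≫ α.left :=
  pullback.lift_fst _ _ _

namespace DescentSystem

variable {k Ω : Type u} [Field k] [Field Ω] [Algebra k Ω] {V : SchemesOver Ω}

/-- The semilinear action on `V` defined by a descent system. -/
def semilinearAction (D : DescentSystem k V) : SemilinearAction k V.hom where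
  act σ := (D.φ σ).inv.left ≫ proj (σ : Ω →+* Ω) V
  act_mul σ τ := by
    have hc := congrArg (·.left) (D.cocycle σ τ)
    dsimp only [Over.comp_left] at hc
    have : IsIso (baseChangeComp (coe_comp_coe σ τ) V).hom.left :=
      inferInstanceAs (IsIso ((Over.forget _).map (baseChangeComp (coe_comp_coe σ τ) V).hom))
    have hid (ρ : Ω ≃ₐ[k] Ω) : (D.φ ρ).hom.left ≫ (D.φ ρ).inv.left = 𝟙 _ := by
      rw [← Over.comp_left, Iso.hom_inv_id, Over.id_left]
    rw [← cancel_epi (D.φ (σ * τ)).hom.left, reassoc_of% (hid (σ * τ)),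
      ← cancel_epi (baseChangeComp (coe_comp_coe σ τ) V).hom.left, baseChangeComp_hom_proj,
      ← reassoc_of% hc, Category.assoc, reassoc_of% (hid σ), ← Category.assoc (Over.Hom.left _),
      baseChange_map_proj, Category.assoc, reassoc_of% (hid τ)]
  act_comp σ := by
    rw [Category.assoc, proj_condition, ← Category.assoc, Over.w]

/-- A morphism over `Ω` into the base change of `M.V₀` is determined by its composite to `M.V₀`, so
the splitting identity may be tested after that projection. -/
lemma isSplitBy_iff (D : DescentSystem k V) {K : Type u} [Field K] [Algebra K Ω] (M : Model K V) :
    D.IsSplitBy M ↔ ∀ σ : Ω ≃ₐ[k] Ω, (σ : Ω →+* Ω).comp (algebraMap K Ω) = algebraMap K Ω →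
      D.semilinearAction.act σ ≫ M.φ.hom.left ≫ proj (algebraMap K Ω) M.V₀ =
        M.φ.hom.left ≫ proj (algebraMap K Ω) M.V₀ := by
  refine forall_congr' fun σ ↦ forall_congr' fun hσ ↦ ?_
  have key : ((baseChange (σ : Ω →+* Ω)).map M.φ.hom ≫ (baseChangeComp hσ M.V₀).hom).left ≫
      proj (algebraMap K Ω) M.V₀ =
        proj (σ : Ω →+* Ω) V ≫ M.φ.hom.left ≫ proj (algebraMap K Ω) M.V₀ := by
    rw [Over.comp_left, Category.assoc, baseChangeComp_hom_proj, ← Category.assoc,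
      baseChange_map_proj, Category.assoc]
  have h1 : D.semilinearAction.act σ ≫ M.φ.hom.left ≫ proj (algebraMap K Ω) M.V₀ =
      (D.φ σ).inv.left ≫ proj (σ : Ω →+* Ω) V ≫ M.φ.hom.left ≫ proj (algebraMap K Ω) M.V₀ :=
    Category.assoc _ _ _
  rw [← Category.assoc, Iso.eq_comp_inv, h1, ← key, ← cancel_epi (D.φ σ).hom.left,
    ← Over.comp_left_assoc, Iso.hom_inv_id, Over.id_left, Category.id_comp]
  constructor
  · intro h
    rw [← h, Over.comp_left, Category.assoc]
  · intro h
    apply baseChange_hom_ext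
    rw [h, Over.comp_left, Category.assoc]

/-- `twist σ U` is the preimage of `U` under `act σ`, since `act σ` is the inverse of `φ σ` followed
by the projection. -/
lemma le_preimage_of_twist_eq (D : DescentSystem k V) {σ : Ω ≃ₐ[k] Ω} {U : V.left.Opens}
    (h : D.twist σ U = U) : U ≤ D.semilinearAction.act σ ⁻¹ᵁ U := by
  intro x hx
  rw [← h] at hx
  obtain ⟨y, hy, rfl⟩ := hx
  change ((D.φ σ).hom.left ≫ (D.φ σ).inv.left ≫ proj (σ : Ω →+* Ω) V) y ∈ U
  rw [← Over.comp_left_assoc, Iso.hom_inv_id, Over.id_left, Category.id_comp]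
  exact hy

end DescentSystem

lemma Model.isPullback {K Ω : Type u} [Field K] [Field Ω] [Algebra K Ω] {V : SchemesOver Ω}
    (M : Model K V) :
    IsPullback (M.φ.hom.left ≫ proj (algebraMap K Ω) M.V₀) V.hom M.V₀.hom
      (Spec.map (CommRingCat.ofHom (algebraMap K Ω))) := by
  refine .of_iso_pullback ⟨?_⟩ ((Over.forget _).mapIso M.φ) rfl (Over.w M.φ.hom)
  rw [Category.assoc, proj_condition, ← Category.assoc, Over.w]

/-- Separatedness descends along fpqc morphisms. -/
lemma isSeparated_of_isPullback {X Y S T : Scheme.{u}} {π : X ⟶ Y} {p : X ⟶ T} {q : Y ⟶ S}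
    {f : T ⟶ S} (h : IsPullback π p q f) [Flat f] [Surjective f] [QuasiCompact f] [IsSeparated p] :
    IsSeparated q := by
  have : (@Surjective ⊓ @Flat ⊓ @QuasiCompact : MorphismProperty Scheme).IsStableUnderBaseChange :=
    ⟨fun sq h ↦ ⟨⟨MorphismProperty.of_isPullback sq h.1.1, MorphismProperty.of_isPullback sq h.1.2⟩,
      MorphismProperty.of_isPullback sq h.2⟩⟩
  have : MorphismProperty.RespectsIso @UniversallyClosed := universallyClosed_respectsIso
  have := descendsAlong_universallyClosed_surjective_inf_flat_inf_quasicompact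
  have : MorphismProperty.DescendsAlong (.diagonal @UniversallyClosed)
      (@Surjective ⊓ @Flat ⊓ @QuasiCompact) :=
    MorphismProperty.instDescendsAlongDiagonalOfRespectsIsoOfIsStableUnderBaseChange _ _
  have : UniversallyClosed (pullback.diagonal q) :=
    MorphismProperty.of_isPullback_of_descendsAlong (P := .diagonal @UniversallyClosed)
      (Q := @Surjective ⊓ @Flat ⊓ @QuasiCompact) h.flip ⟨⟨‹_›, ‹_›⟩, ‹_›⟩
      (inferInstanceAs (UniversallyClosed (pullback.diagonal p)))
  -- The diagonal is always an immersion, so closed range suffices; universal closedness, which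
  -- descends, supplies it.
  exact ⟨.of_isPreimmersion _ (pullback.diagonal q).isClosedMap.isClosed_range⟩

/-- Being an algebraic scheme descends along field extensions. -/
lemma isAlgebraicScheme_of_isPullback {K Ω : Type u} [Field K] [Field Ω] [Algebra K Ω]
    {V : SchemesOver Ω} (hV : IsAlgebraicScheme V) {Y : SchemesOver K} {π : V.left ⟶ Y.left}
    (h : IsPullback π V.hom Y.hom (Spec.map (CommRingCat.ofHom (algebraMap K Ω)))) :
    IsAlgebraicScheme Y := by
  have := hV.separated
  have := hV.locallyOfFiniteType
  have := hV.quasiCompact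
  have := (faithfullyFlat_specMap K Ω).1
  have := (faithfullyFlat_specMap K Ω).2
  have : Surjective π := MorphismProperty.of_isPullback h.flip this
  have : CompactSpace V.left := (quasiCompact_iff_compactSpace V.hom).mp inferInstance
  have : CompactSpace Y.left := π.surjective.compactSpace π.continuous
  exact ⟨isSeparated_of_isPullback h,
    MorphismProperty.of_isPullback_of_descendsAlong (P := @LocallyOfFiniteType)
      (Q := @Surjective ⊓ @Flat ⊓ @QuasiCompact) h.flip ⟨⟨‹_›, ‹_›⟩, inferInstance⟩ ‹_›,
    (quasiCompact_iff_compactSpace Y.hom).mpr inferInstance⟩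

end FieldDescent

end

theorem theorem6p1 {k Ω : Type u} [Field k] [Field Ω] [Algebra k Ω] [IsGalois k Ω]
    (V : FieldDescent.SchemesOver Ω) (hV : FieldDescent.IsAlgebraicScheme V)
    (D : FieldDescent.DescentSystem k V) (hD : D.IsContinuous)
    (hU : ∀ x : V.left, ∃ U : V.left.Opens,
      x ∈ U ∧ IsAffineOpen U ∧ ∀ σ : Ω ≃ₐ[k] Ω, D.twist σ U = U) :
    D.IsEffective := by
  obtain ⟨K, ⟨S, hS⟩, M, hM⟩ := hD
  -- A finitely generated algebraic extension is finite.
  have : FiniteDimensional k K := by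
    rw [← hS]
    exact IntermediateField.finiteDimensional_adjoin fun x _ ↦ Algebra.IsIntegral.isIntegral x
  have := hV.separated
  obtain ⟨Y, q, π, h, hπ⟩ := D.semilinearAction.exists_quotient
    (fun U hU s ↦ D.semilinearAction.isContinuousSection_of_isCompact K M.isPullback
      (fun σ hσ ↦ (D.isSplitBy_iff M).mp hM σ (RingHom.ext fun x ↦ hσ _ x.2))
      hU.1.isCompact hU.2 s)
    fun x ↦ by
      obtain ⟨U, hx, hUa, hUσ⟩ := hU x
      exact ⟨U, ⟨hUa, fun σ ↦ D.le_preimage_of_twist_eq (hUσ σ)⟩, hx⟩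
  let N : FieldDescent.Model k V :=
    { V₀ := Over.mk q
      isAlgebraicScheme := FieldDescent.isAlgebraicScheme_of_isPullback hV h
      φ := Over.isoMk h.isoPullback h.isoPullback_hom_snd }
  have hN : N.φ.hom.left ≫ FieldDescent.proj (algebraMap k Ω) N.V₀ = π := h.isoPullback_hom_fst
  refine ⟨N, (D.isSplitBy_iff N).mpr fun σ _ ↦ ?_⟩
  rw [hN, hπ]
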